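/- Let $\mathbb{N}=\{1,2,3,\dots\}$. For a group $\Gamma$ generated by a finite set $S$, let $|\cdot|_S$ be the word length on $\Gamma$; let $F_k$ be the free group of rank $k$ with word length $|\cdot|$ with respect to a fixed free basis. An element $1\neq w\in F_k$ is a law for $\Gamma$ if it is killed by every homomorphism $F_k\to\Gamma$, and $\Gamma$ is lawless if it has no law in any $F_k$. For $\Gamma$ lawless, $k\ge 2$ and $n\in\mathbb{N}$ put $$\chi_\Gamma^S(w)=\min\Big\{\sum_{i=1}^k|g_i|_S : g_1,\dots,g_k\in\Gamma,\ w(g_1,\dots,g_k)\neq e\Big\},\qquad \mathcal{A}_\Gamma^S(n)=\max\{\chi_\Gamma^S(w) : 1\neq w\in F_k,\ |w|\le n\}.$$ For functions $F_1,F_2$ on $\mathbb{N}$ write $F_1\preceq F_2$ if there is $K\in\mathbb{N}$ with $F_1(l)\le K\,F_2(Kl)$ for all $l\in\mathbb{N}$, and $F_1\approx F_2$ if $F_1\preceq F_2$ and $F_2\preceq F_1$. The class of elementary amenable groups is the smallest class of groups that contains all finite groups and $\mathbb{Z}$ and is closed under subgroups, quotients, extensions and directed limits. **Theorem.** Let $f:\mathbb{N}\to\mathbb{N}$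 be an unbounded nondecreasing function. Suppose that there exist a function $g:\mathbb{N}\to\mathbb{N}$ with $f(g(n))=n$ for all $n\in\mathbb{N}$ and a constant $M\in\mathbb{N}$ with $g(Mn)\ge 93\,g(n)$ for all $n\in\mathbb{N}$. Then there exists an elementary amenable lawless group $\Gamma$, generated by a finite set $S$, such that $\mathcal{A}_\Gamma^S\approx f$, for every choice of the rank $k\ge 2$ in the definition of $\mathcal{A}_\Gamma^S$. -/

import Mathlib

universe u

/-- The elementary amenable groups: the smallest class of groups which contains all finite groups
and the infinite cyclic group and is closed under subgroups, quotients, extensions and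
directed limits (all up to isomorphism). -/
inductive IsElementaryAmenable : ∀ (G : Type u) [Group G], Prop
  | of_finite (G : Type u) [Group G] [Finite G] : IsElementaryAmenable G
  | int : IsElementaryAmenable (Multiplicative (ULift.{u} ℤ))
  | subgroup {G H : Type u} [Group G] [Group H] (φ : H →* G) (hφ : Function.Injective φ)
      (hG : IsElementaryAmenable G) : IsElementaryAmenable H
  | quotient {G Q : Type u} [Group G] [Group Q] (φ : G →* Q) (hφ : Function.Surjective φ)
      (hG : IsElementaryAmenable G) : IsElementaryAmenable Q
  | extension {G Q : Type u} [Group G] [Group Q] (φ : G →* Q) (hφ : Function.Surjective φ)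
      (hker : IsElementaryAmenable φ.ker) (hQ : IsElementaryAmenable Q) :
      IsElementaryAmenable G
  | directLimit {ι : Type u} [Preorder ι] [IsDirectedOrder ι] [Nonempty ι]
      (G : ι → Type u) [∀ i, Group (G i)] (f : ∀ i j, i ≤ j → G i →* G j)
      [DirectedSystem G (fun i j h => f i j h)]
      (hG : ∀ i, IsElementaryAmenable (G i)) : IsElementaryAmenable (DirectLimit G f)

/-- A nontrivial element `w` of a free group is a law for `Γ` if every homomorphism from
the free group to `Γ` kills it. -/
def IsLaw {α : Type*} (Γ : Type*) [Group Γ] (w : FreeGroup α) : Prop :=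
  w ≠ 1 ∧ ∀ π : FreeGroup α →* Γ, π w = 1

/-- `Γ` is lawless if it has no law in any free group of finite rank. -/
def IsLawless (Γ : Type*) [Group Γ] : Prop :=
  ∀ (k : ℕ) (w : FreeGroup (Fin k)), ¬ IsLaw Γ w

/-- The word length of `g` with respect to `S`: the least length of a word in `S ∪ S⁻¹` that
represents `g` (and `⊤` if there is none, which does not occur if `S` generates). -/
noncomputable def wordLength {Γ : Type*} [Group Γ] (S : Set Γ) (g : Γ) : ℕ∞ :=
  ⨅ (l : List Γ) (_ : (∀ x ∈ l, x ∈ S ∨ x⁻¹ ∈ S) ∧ l.prod = g), (l.length : ℕ∞)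

/-- The complexity of `w` in `Γ` with respect to `S`: the least value of `|g₁| + ⋯ + |gₖ|` over
the tuples `(g₁, …, gₖ)` with `w(g₁, …, gₖ) ≠ 1` (and `⊤` if there is no such tuple). -/
noncomputable def wordComplexity {Γ : Type*} [Group Γ] (S : Set Γ) {k : ℕ}
    (w : FreeGroup (Fin k)) : ℕ∞ :=
  ⨅ (g : Fin k → Γ) (_ : FreeGroup.lift g w ≠ 1), ∑ i, wordLength S (g i)

/-- The lawlessness growth of `Γ` with respect to `S`, computed in the free group of rank `k`: the
maximum of the complexities of the nontrivial elements of that free group of length at most `n`. -/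
noncomputable def lawlessnessGrowth {Γ : Type*} [Group Γ] (S : Set Γ) (k : ℕ) (n : ℕ+) : ℕ∞ :=
  ⨆ (w : FreeGroup (Fin k)) (_ : w ≠ 1 ∧ w.norm ≤ (n : ℕ)), wordComplexity S w

/-- `F₁ ≼ F₂`: there is a positive integer `K` with `F₁(l) ≤ K F₂(K l)` for all positive
integers `l`. -/
def GrowthLE (F₁ F₂ : ℕ+ → ℕ∞) : Prop :=
  ∃ K : ℕ+, ∀ l : ℕ+, F₁ l ≤ ((K : ℕ) : ℕ∞) * F₂ (K * l)

/-- `F₁ ≈ F₂`: equivalence of growth functions. -/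
def GrowthEquiv (F₁ F₂ : ℕ+ → ℕ∞) : Prop :=
  GrowthLE F₁ F₂ ∧ GrowthLE F₂ F₁

/-!
# Elementary amenable groups with prescribed lawlessness growth

The group is generated inside the unrestricted product of copies of finite groups `H j`, one for
each pair `(j, m) ∈ ℕ × ℤ`, extended by `ℤ` acting by translation of `m`. Each `H j` comes with a
pair `c j 0, c j 1`, and the generators are the translation, the family with `c j 0` at `(j, 0)`,
and the family with `c j 1` at `(j, n j)`, for a strictly increasing sequence `n`.

Two facts about a product of `R` generators control everything. Its component at a given place lies
in a cyclic group, generated by `c j 0` or by `c j 1`, unless the place is within `R` of both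
`(j, 0)` and `(j, n j)` (`Lamplighter.left_mem_zpowers`); so two elements of the base group of
length at most `R` have commuting components at all places with `n j > 2 * R`. On the other hand, in
length `2 * n j + 1` one can translate `c j 1` to the place `(j, 0)`, so that words in `c j 0` and
`c j 1` become available there (`Lamplighter.exists_lift_ne_one`). The first fact also shows that
commutators in the base group have finite support, so that the group is (locally finite)-by-abelian
by `ℤ`, hence elementary amenable (`Lamplighter.isElementaryAmenable`).

For `H j` take the functions from `𝔽_p` to `SL₂(𝔽_p)`, where `p = p j`. An element of `SL₂(𝔽_p)` has
order dividing `p - 1`, `p + 1` or `2p` (`SL2.pow_eq_one`), so that an iterated commutator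
(`FreeGroup.lawWord`) is a law of length linear in `p`. But the pair of functions `SL2.genPair`
satisfies no relation of length less than `p`, because a word in it is a nonconstant polynomial in
the parameter, of degree at most the length of the word (`SL2.lift_genPair_ne_one`).

If the `p j` grow at least geometrically, there is a common law for `H 0, …, H j`, vanishing on
commuting pairs, of length linear in `p j`. Evaluated at elements of the base group it kills all
tuples which are short compared to `n (j + 1)`. Conversely a nontrivial word which is short compared
to `p j` is detected at the place `(j, 0)` by elements of length linear in `n j`. Hence the
lawlessness growth is between constant multiples of `n (j + 1)` for lengths between constant
multiples of `p j` and `p (j + 1)`. With `n j = M ^ (2 * j)`, and `p j` a prime comparable to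
`g (n j)`, which exists by Bertrand's postulate, this is the growth of `f`.
-/

/-! ### Word length -/

/-- The element `g` is a product of at most `n` elements of `S ∪ S⁻¹`. -/
def HasLengthLE {G : Type*} [Group G] (S : Set G) (n : ℕ) (g : G) : Prop :=
  ∃ l : List G, (∀ x ∈ l, x ∈ S ∨ x⁻¹ ∈ S) ∧ l.prod = g ∧ l.length ≤ n

namespace HasLengthLE

variable {G : Type*} [Group G] {S : Set G} {m n : ℕ} {g h : G}

theorem of_mem (hg : g ∈ S) : HasLengthLE S 1 g :=
  ⟨[g], by simp [hg], by simp, by simp⟩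

theorem one : HasLengthLE S 0 (1 : G) :=
  ⟨[], by simp, by simp, by simp⟩

theorem mul (hg : HasLengthLE S m g) (hh : HasLengthLE S n h) :
    HasLengthLE S (m + n) (g * h) := by
  obtain ⟨l, hl, rfl, hlm⟩ := hg
  obtain ⟨l', hl', rfl, hln⟩ := hh
  refine ⟨l ++ l', fun x hx => ?_, by simp, by simp; omega⟩
  rcases List.mem_append.1 hx with hx | hx
  · exact hl x hx
  · exact hl' x hx

theorem inv (hg : HasLengthLE S m g) : HasLengthLE S m g⁻¹ := by
  obtain ⟨l, hl, rfl, hlm⟩ := hg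
  refine ⟨(l.map (·⁻¹)).reverse, fun x hx => ?_, ?_, by simpa using hlm⟩
  · simp only [List.mem_reverse, List.mem_map] at hx
    obtain ⟨y, hy, rfl⟩ := hx
    rw [inv_inv]
    exact (hl y hy).symm
  · exact (List.prod_inv_reverse l).symm

theorem pow (hg : HasLengthLE S m g) (n : ℕ) : HasLengthLE S (n * m) (g ^ n) := by
  induction n with
  | zero => simpa using one
  | succ n ih =>
    rw [pow_succ, Nat.succ_mul]
    exact ih.mul hg

theorem mono (hg : HasLengthLE S m g) (hmn : m ≤ n) : HasLengthLE S n g := by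
  obtain ⟨l, hl, h, hlm⟩ := hg
  exact ⟨l, hl, h, hlm.trans hmn⟩

theorem map {G' : Type*} [Group G'] (φ : G →* G') {S' : Set G'} (hS : ∀ x ∈ S, φ x ∈ S')
    (hg : HasLengthLE S m g) : HasLengthLE S' m (φ g) := by
  obtain ⟨l, hl, rfl, hlm⟩ := hg
  refine ⟨l.map φ, fun x hx => ?_, (map_list_prod φ l).symm, by simpa using hlm⟩
  obtain ⟨y, hy, rfl⟩ := List.mem_map.1 hx
  rcases hl y hy with h | h
  · exact Or.inl (hS y h)
  · exact Or.inr (by simpa using hS _ h)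

theorem exists_of_mem_closure (hg : g ∈ Subgroup.closure S) : ∃ n, HasLengthLE S n g := by
  induction hg using Subgroup.closure_induction with
  | mem x hx => exact ⟨1, of_mem hx⟩
  | one => exact ⟨0, one⟩
  | mul x y _ _ hx hy =>
    obtain ⟨m, hm⟩ := hx
    obtain ⟨n, hn⟩ := hy
    exact ⟨m + n, hm.mul hn⟩
  | inv x _ hx =>
    obtain ⟨m, hm⟩ := hx
    exact ⟨m, hm.inv⟩

end HasLengthLE

theorem wordLength_le_iff {G : Type*} [Group G] {S : Set G} {n : ℕ} {g : G} :
    wordLength S g ≤ n ↔ HasLengthLE S n g := by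
  constructor
  · intro h
    have h' : wordLength S g < ((n + 1 : ℕ) : ℕ∞) :=
      h.trans_lt (by exact_mod_cast Nat.lt_succ_self n)
    simp only [wordLength, iInf_lt_iff] at h'
    obtain ⟨l, ⟨hl, hg⟩, hn⟩ := h'
    exact ⟨l, hl, hg, Nat.lt_succ_iff.1 (by exact_mod_cast hn)⟩
  · rintro ⟨l, hl, hg, hn⟩
    exact (iInf₂_le l ⟨hl, hg⟩).trans (by exact_mod_cast hn)

/-- A lower bound for the complexity of `w`: it exceeds `R` as soon as `w` is killed by all tuples
of elements of length at most `R`. -/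
theorem lt_wordComplexity {G : Type*} [Group G] {S : Set G} {k : ℕ} {w : FreeGroup (Fin k)}
    {R : ℕ} (h : ∀ g : Fin k → G, (∀ i, HasLengthLE S R (g i)) → FreeGroup.lift g w = 1) :
    (R : ℕ∞) + 1 ≤ wordComplexity S w := by
  refine le_iInf₂ fun g hg => ?_
  by_contra hlt
  refine hg (h g fun i => wordLength_le_iff.1 ?_)
  have h1 : wordLength S (g i) ≤ ∑ i, wordLength S (g i) :=
    Finset.single_le_sum (f := fun i => wordLength S (g i)) (fun _ _ => zero_le)
      (Finset.mem_univ i)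
  exact h1.trans (Order.le_of_lt_add_one (not_le.1 hlt))

theorem wordComplexity_le {G : Type*} [Group G] {S : Set G} {k : ℕ} {w : FreeGroup (Fin k)}
    {R : ℕ} (g : Fin k → G) (hg : ∀ i, HasLengthLE S R (g i)) (hw : FreeGroup.lift g w ≠ 1) :
    wordComplexity S w ≤ ((k * R : ℕ) : ℕ∞) := by
  refine (iInf₂_le g hw).trans ?_
  refine (Finset.sum_le_sum fun i _ => wordLength_le_iff.2 (hg i)).trans ?_
  simp

/-! ### Elementary amenable groups -/

namespace IsElementaryAmenable

/-- A group is elementary amenable if its finitely generated subgroups are: it is a quotient of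
(in fact isomorphic to) the direct limit of these subgroups. -/
theorem of_closure_finset {G : Type} [Group G]
    (h : ∀ s : Finset G, IsElementaryAmenable (Subgroup.closure (s : Set G))) :
    IsElementaryAmenable G := by
  classical
  have hle : ∀ s t : Finset G, s ≤ t →
      Subgroup.closure (s : Set G) ≤ Subgroup.closure (t : Set G) :=
    fun s t hst => Subgroup.closure_mono (by exact_mod_cast hst)
  let f : ∀ s t : Finset G, s ≤ t →
      Subgroup.closure (s : Set G) →* Subgroup.closure (t : Set G) :=
    fun s t hst => Subgroup.inclusion (hle s t hst)
  have : DirectedSystem (fun s : Finset G => Subgroup.closure (s : Set G))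
      (fun s t hst => f s t hst) :=
    ⟨fun _ _ => rfl, fun _ _ _ _ _ _ => rfl⟩
  let φ : DirectLimit (fun s : Finset G => Subgroup.closure (s : Set G)) f →* G :=
    { toFun := DirectLimit.lift f (fun s => (Subgroup.closure (s : Set G)).subtype)
        (fun _ _ _ _ => rfl)
      map_one' := DirectLimit.lift_one _ _
      map_mul' := DirectLimit.lift_mul _ _ }
  refine quotient φ (fun g => ⟨⟦⟨{g}, ⟨g, Subgroup.subset_closure (by simp)⟩⟩⟧, rfl⟩)
    (directLimit _ f h)

theorem prod {A B : Type} [Group A] [Group B] (hA : IsElementaryAmenable A)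
    (hB : IsElementaryAmenable B) : IsElementaryAmenable (A × B) := by
  refine extension (MonoidHom.snd A B) Prod.snd_surjective ?_ hB
  refine subgroup ((MonoidHom.fst A B).comp (MonoidHom.snd A B).ker.subtype) ?_ hA
  rintro ⟨⟨x, y⟩, hx⟩ ⟨⟨x', y'⟩, hx'⟩ h
  simp only [MonoidHom.mem_ker, MonoidHom.coe_snd] at hx hx'
  subst hx hx'
  simpa using h

theorem multiplicative_int : IsElementaryAmenable (Multiplicative ℤ) :=
  quotient (AddMonoidHom.toMultiplicative (AddEquiv.ulift (α := ℤ)).toAddMonoidHom)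
    (fun x => ⟨Multiplicative.ofAdd ⟨x.toAdd⟩, rfl⟩) int

theorem of_commGroup (A : Type) [CommGroup A] : IsElementaryAmenable A := by
  classical
  refine of_closure_finset fun s => ?_
  induction s using Finset.induction_on with
  | empty =>
    have : Finite (Subgroup.closure ((∅ : Finset A) : Set A)) := by
      rw [Finset.coe_empty, Subgroup.closure_empty]
      infer_instance
    exact of_finite _
  | insert x s _ ih =>
    -- The subgroup generated by `s ∪ {x}` is a quotient of `⟨s⟩ × ℤ`.
    have hx : x ∈ Subgroup.closure ((insert x s : Finset A) : Set A) :=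
      Subgroup.subset_closure (by simp)
    have hs : Subgroup.closure (s : Set A) ≤ Subgroup.closure ((insert x s : Finset A) : Set A) :=
      Subgroup.closure_mono (by simp)
    refine quotient (MonoidHom.coprod (Subgroup.inclusion hs) (zpowersHom _ ⟨x, hx⟩)) ?_
      (ih.prod multiplicative_int)
    rintro ⟨y, hy⟩
    rw [Finset.coe_insert, Set.insert_eq, Subgroup.closure_union, Subgroup.mem_sup] at hy
    obtain ⟨u, hu, v, hv, rfl⟩ := hy
    obtain ⟨n, rfl⟩ := Subgroup.mem_closure_singleton.1 hu
    refine ⟨(⟨v, hv⟩, Multiplicative.ofAdd n), Subtype.ext ?_⟩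
    simp [mul_comm]

/-- A subgroup of a product of finite groups is elementary amenable if all its elements have
finite support: its finitely generated subgroups are finite. -/
theorem of_finite_support {ι : Type} {H : ι → Type} [∀ i, Group (H i)] [∀ i, Finite (H i)]
    {G : Type} [Group G] (φ : G →* ∀ i, H i) (hφ : Function.Injective φ)
    (hfin : ∀ g, {i | φ g i ≠ 1}.Finite) : IsElementaryAmenable G := by
  classical
  refine of_closure_finset fun s => ?_
  have hF : (⋃ g ∈ s, {i | φ g i ≠ 1}).Finite := s.finite_toSet.biUnion fun g _ => hfin g
  set F : Set ι := ⋃ g ∈ s, {i | φ g i ≠ 1} with hFdef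
  have : Finite F := hF
  have hsupp : ∀ g ∈ Subgroup.closure (s : Set G), ∀ i, i ∉ F → φ g i = 1 := by
    intro g hg i hi
    induction hg using Subgroup.closure_induction with
    | mem x hx =>
      by_contra hne
      exact hi (Set.mem_biUnion hx hne)
    | one => simp
    | mul x y _ _ hx hy => simp [hx, hy]
    | inv x _ hx => simp [hx]
  let ψ : Subgroup.closure (s : Set G) →* ∀ i : F, H i :=
    { toFun := fun g i => φ g i
      map_one' := by ext; simp
      map_mul' := fun x y => by ext; simp }
  refine subgroup ψ ?_ (of_finite _)
  intro x y hxy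
  apply Subtype.ext
  apply hφ
  ext i
  by_cases hi : i ∈ F
  · exact congrFun hxy ⟨i, hi⟩
  · rw [hsupp _ x.2 i hi, hsupp _ y.2 i hi]

end IsElementaryAmenable

/-! ### The group `SL₂(𝔽_p)`: a law of length linear in `p` -/

/-- An element of `SL₂(𝔽_p)` with eigenvalue `1` is unipotent, hence has order dividing `p`. -/
theorem SL2.pow_eq_one_of_det_sub_one {p : ℕ} [Fact p.Prime]
    (A : Matrix.SpecialLinearGroup (Fin 2) (ZMod p))
    (h : ((A : Matrix (Fin 2) (Fin 2) (ZMod p)) - 1).det = 0) : A ^ p = 1 := by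
  have hdet := A.det_coe
  rw [Matrix.det_fin_two] at h hdet
  simp only [Matrix.sub_apply, Matrix.one_apply_eq, ne_eq, zero_ne_one, not_false_eq_true,
    one_ne_zero, Matrix.one_apply_ne, sub_zero] at h
  have htr : A.1 0 0 + A.1 1 1 = 2 := by linear_combination hdet - h
  have hsq : ((A : Matrix (Fin 2) (Fin 2) (ZMod p)) - 1) ^ 2 = 0 := by
    rw [pow_two]
    ext i j
    fin_cases i <;> fin_cases j <;> simp [Matrix.mul_apply, Fin.sum_univ_two]
    · linear_combination A.1 0 0 * htr - hdet
    · linear_combination A.1 0 1 * htr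
    · linear_combination A.1 1 0 * htr
    · linear_combination A.1 1 1 * htr - hdet
  have hp : ((A : Matrix (Fin 2) (Fin 2) (ZMod p)) - 1) ^ p = 0 :=
    pow_eq_zero_of_le (Fact.out : p.Prime).two_le hsq
  rw [sub_pow_char_of_commute p (Commute.one_right _), one_pow, sub_eq_zero] at hp
  exact Subtype.ext ((Matrix.SpecialLinearGroup.coe_pow A p).trans hp)

/-- Every element `A` of `SL₂(𝔽_p)` has order dividing `p - 1` (distinct eigenvalues in `𝔽_p`),
`p + 1` (eigenvalues outside `𝔽_p`) or `2p` (a double eigenvalue). As `A + A⁻¹` is scalar, it is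
fixed by the Frobenius map, which gives `(A ^ (p - 1) - 1) * (A ^ (p + 1) - 1) = 0`. -/
theorem SL2.pow_eq_one {p : ℕ} [Fact p.Prime] (A : Matrix.SpecialLinearGroup (Fin 2) (ZMod p)) :
    A ^ (p - 1) = 1 ∨ A ^ (p + 1) = 1 ∨ A ^ (2 * p) = 1 := by
  obtain ⟨q, hq⟩ : ∃ q, p = q + 1 := ⟨p - 1, (Nat.succ_pred_prime Fact.out).symm⟩
  set B : Matrix (Fin 2) (Fin 2) (ZMod p) := (A : Matrix (Fin 2) (Fin 2) (ZMod p)) with hB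
  set C : Matrix (Fin 2) (Fin 2) (ZMod p) :=
    ((A⁻¹ : Matrix.SpecialLinearGroup (Fin 2) (ZMod p)) : Matrix (Fin 2) (Fin 2) (ZMod p)) with hC
  have hBC : B * C = 1 := by rw [hB, hC, ← Matrix.SpecialLinearGroup.coe_mul]; simp
  have hCB : C * B = 1 := by rw [hB, hC, ← Matrix.SpecialLinearGroup.coe_mul]; simp
  have hcomm : Commute B C := hBC.trans hCB.symm
  have hsum : B + C = (B.trace) • (1 : Matrix (Fin 2) (Fin 2) (ZMod p)) := by
    rw [hC, Matrix.SpecialLinearGroup.coe_inv, ← hB, Matrix.adjugate_fin_two, Matrix.trace_fin_two]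
    ext i j
    fin_cases i <;> fin_cases j <;> simp [add_comm]
  have hfrob : B ^ p + C ^ p = B + C := by
    rw [← add_pow_char_of_commute p hcomm, hsum, smul_pow, one_pow, ZMod.pow_card]
  have hBCp : B ^ p * C ^ p = 1 := by rw [← hcomm.mul_pow, hBC, one_pow]
  have hzero : (B ^ (p - 1) - 1) * (B ^ (p + 1) - 1) = 0 := by
    have h1 : B ^ (p - 1) * B ^ (p + 1) = B ^ p * B ^ p := by
      rw [← pow_add, ← pow_add]; congr 1; omega
    have h2 : B ^ p * C = B ^ (p - 1) := by
      have : B ^ p = B ^ (p - 1) * B := by rw [← pow_succ]; congr 1; omega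
      rw [this, mul_assoc, hBC, mul_one]
    have h3 : B ^ p * (B ^ p + C ^ p) = B ^ p * (B + C) := by rw [hfrob]
    rw [mul_add, mul_add, hBCp, h2, ← pow_succ] at h3
    rw [sub_mul, mul_sub, one_mul, mul_one, h1, sub_sub_sub_eq, sub_eq_zero]
    rw [h3, add_comm]
  have hdet : (B ^ (p - 1) - 1).det * (B ^ (p + 1) - 1).det = 0 := by
    rw [← Matrix.det_mul, hzero, Matrix.det_zero]
  have key : ∀ n : ℕ, B ^ n = 1 → A ^ n = 1 := fun n hn =>
    Subtype.ext ((Matrix.SpecialLinearGroup.coe_pow A n).trans hn)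
  by_cases h1 : (B ^ (p - 1) - 1).det = 0
  · by_cases h2 : (B ^ (p + 1) - 1).det = 0
    · right; right
      have e1 := SL2.pow_eq_one_of_det_sub_one (A ^ (p - 1)) (by simpa [hB] using h1)
      have e2 := SL2.pow_eq_one_of_det_sub_one (A ^ (p + 1)) (by simpa [hB] using h2)
      rw [← pow_mul] at e1 e2
      have : (p + 1) * p = 2 * p + (p - 1) * p := by subst hq; simp; ring
      rw [this, pow_add, e1, mul_one] at e2
      exact e2
    · left
      apply key
      have hu : IsUnit (B ^ (p + 1) - 1) := (Matrix.isUnit_iff_isUnit_det _).2 (Ne.isUnit h2)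
      exact sub_eq_zero.1 ((hu.mul_left_eq_zero).1 hzero)
  · right; left
    apply key
    have hu : IsUnit (B ^ (p - 1) - 1) := (Matrix.isUnit_iff_isUnit_det _).2 (Ne.isUnit h1)
    exact sub_eq_zero.1 ((hu.mul_right_eq_zero).1 hzero)

/-! ### The group `SL₂(𝔽_p)`: a pair of functions without short relations -/

open Polynomial in
/-- The linear combination of two polynomials of degree at most `n` with coefficients `a * X + b`
and `c * X + d`, in degree `n + 1`. -/
theorem Polynomial.coeff_linear_combination {F : Type*} [Field F] {n : ℕ} {P Q : F[X]}
    (hP : P.natDegree ≤ n) (hQ : Q.natDegree ≤ n) (a b c d e : F) (q : F[X])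
    (hq : q = (C a * X + C b) * P + (C c * X + C d) * Q)
    (he : e = a * P.coeff n + c * Q.coeff n) :
    q.natDegree ≤ n + 1 ∧ q.coeff (n + 1) = e := by
  subst hq he
  constructor
  · refine natDegree_add_le_of_degree_le ?_ ?_
    · refine natDegree_mul_le.trans ?_
      have := natDegree_linear_le (a := a) (b := b)
      omega
    · refine natDegree_mul_le.trans ?_
      have := natDegree_linear_le (a := c) (b := d)
      omega
  · have hP' : P.coeff (n + 1) = 0 := coeff_eq_zero_of_natDegree_lt (by omega)
    have hQ' : Q.coeff (n + 1) = 0 := coeff_eq_zero_of_natDegree_lt (by omega)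
    simp [add_mul, mul_assoc, coeff_C_mul, coeff_X_mul, hP', hQ']

namespace SL2

/-- The matrix `A(r) = !![r, -1; 1, 0]` and its conjugate by `!![1, 1; 1, 2]`. For large `r` they
behave like hyperbolic elements in general position. -/
def genPair {R : Type*} [CommRing R] (r : R) : Fin 2 → Matrix.SpecialLinearGroup (Fin 2) R :=
  ![⟨!![r, -1; 1, 0], by simp [Matrix.det_fin_two_of]⟩,
    ⟨!![2 * r + 3, -r - 2; 2 * r + 5, -r - 3], by rw [Matrix.det_fin_two_of]; ring⟩]

/-- A letter of `FreeGroup (Fin 2)`, evaluated at the matrices `genPair X`. -/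
noncomputable def polyLetter (F : Type*) [Field F] (c : Fin 2 × Bool) :
    Matrix.SpecialLinearGroup (Fin 2) (Polynomial F) :=
  cond c.2 (genPair Polynomial.X c.1) (genPair Polynomial.X c.1)⁻¹

/-- The leading coefficient of the matrix `polyLetter F c` has rank one. This vector spans its
image. -/
def leadVec (F : Type*) [Field F] (c : Fin 2 × Bool) : Fin 2 → F :=
  ![cond c.2 ![1, 0] ![0, 1], cond c.2 ![1, 1] ![1, 2]] c.1

/-- The leading coefficient of the matrix `polyLetter F c` is `leadVec F c` times this row
vector. -/
def leadCovec (F : Type*) [Field F] (c : Fin 2 × Bool) : Fin 2 → F :=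
  ![cond c.2 ![1, 0] ![0, 1], cond c.2 ![2, -1] ![-1, 1]] c.1

open Polynomial in
theorem polyLetter_mulVec {F : Type*} [Field F] (c : Fin 2 × Bool) {n : ℕ} (v : Fin 2 → F[X])
    (hv : ∀ i, (v i).natDegree ≤ n) (i : Fin 2) :
    (((polyLetter F c).1.mulVec v) i).natDegree ≤ n + 1 ∧
      (((polyLetter F c).1.mulVec v) i).coeff (n + 1) =
        leadVec F c i * (leadCovec F c 0 * (v 0).coeff n + leadCovec F c 1 * (v 1).coeff n) := by
  have key := Polynomial.coeff_linear_combination (hv 0) (hv 1)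
  obtain ⟨j, ε⟩ := c
  have hX (m : ℕ) [m.AtLeastTwo] : (OfNat.ofNat m : F[X]) = C (OfNat.ofNat m) := rfl
  rw [Matrix.mulVec, dotProduct, Fin.sum_univ_two]
  fin_cases j <;> cases ε <;> fin_cases i <;>
    simp only [polyLetter, genPair, leadVec, leadCovec, cond, Fin.zero_eta, Fin.mk_one,
      Matrix.cons_val_zero, Matrix.cons_val_one, Matrix.SpecialLinearGroup.coe_inv,
      Matrix.cons_val', Matrix.cons_val_fin_one]
  · exact key 0 0 0 1 _ _ (by simp) (by simp)
  · exact key 0 (-1) 1 0 _ _ (by simp) (by simp)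
  · exact key 1 0 0 (-1) _ _ (by simp) (by simp)
  · exact key 0 1 0 0 _ _ (by simp) (by simp)
  · exact key (-1) (-3) 1 2 _ _ (by simp [hX, -mul_eq_mul_right_iff]; ring) (by simp)
  · exact key (-2) (-5) 2 3 _ _ (by simp [hX, -mul_eq_mul_right_iff]; ring) (by simp; ring)
  · exact key 2 3 (-1) (-2) _ _ (by simp [hX, -mul_eq_mul_right_iff]; ring) (by simp)
  · exact key 2 5 (-1) (-3) _ _ (by simp [hX, -mul_eq_mul_right_iff]; ring) (by simp)

/-- Letters which are not inverse to each other are in general position. -/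
theorem leadCovec_leadVec_ne_zero {F : Type*} [Field F] (h2 : (2 : F) ≠ 0) (c c' : Fin 2 × Bool)
    (h : c.1 = c'.1 → c.2 = c'.2) :
    leadCovec F c 0 * leadVec F c' 0 + leadCovec F c 1 * leadVec F c' 1 ≠ 0 := by
  have h1 : (2 : F) + -1 = 1 := by ring
  have h1' : (-1 : F) + 2 = 1 := by ring
  obtain ⟨j, ε⟩ := c
  obtain ⟨j', ε'⟩ := c'
  revert h
  fin_cases j <;> fin_cases j' <;> cases ε <;> cases ε' <;>
    simp [leadVec, leadCovec, h2, h1, h1']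

open Polynomial in
/-- The leading coefficient of a reduced word in the matrices `genPair X`, applied to the constant
vector `(1, 3)`, is nonzero: no cancellation occurs when a letter is added. -/
theorem natDegree_coeff_prod_mulVec {F : Type*} [Field F] (h2 : (2 : F) ≠ 0) (h3 : (3 : F) ≠ 0)
    (c : Fin 2 × Bool) (L : List (Fin 2 × Bool)) (hL : FreeGroup.IsReduced (c :: L)) :
    ∃ s : F, s ≠ 0 ∧ ∀ i,
      ((((c :: L).map (polyLetter F)).prod.1.mulVec ![1, 3]) i).natDegree ≤ L.length + 1 ∧
      ((((c :: L).map (polyLetter F)).prod.1.mulVec ![1, 3]) i).coeff (L.length + 1) =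
        leadVec F c i * s := by
  induction L generalizing c with
  | nil =>
    refine ⟨leadCovec F c 0 * 1 + leadCovec F c 1 * 3, ?_, fun i => ?_⟩
    · have h1 : (2 : F) + -3 = -1 := by ring
      have h1' : (-1 : F) + 3 = 2 := by ring
      obtain ⟨j, ε⟩ := c
      fin_cases j <;> cases ε <;> simp [leadCovec, h2, h3, h1, h1']
    · have hC : (3 : F[X]) = C 3 := rfl
      have := polyLetter_mulVec c (n := 0) ![1, (3 : F[X])]
        (by intro i; fin_cases i <;> simp [hC]) i
      simpa [hC] using this
  | cons c' L ih =>
    rw [FreeGroup.isReduced_cons_cons] at hL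
    obtain ⟨s, hs, h⟩ := ih c' hL.2
    refine ⟨(leadCovec F c 0 * leadVec F c' 0 + leadCovec F c 1 * leadVec F c' 1) * s,
      mul_ne_zero (leadCovec_leadVec_ne_zero h2 c c' hL.1) hs, fun i => ?_⟩
    have := polyLetter_mulVec c _ (fun i => (h i).1) i
    rw [(h 0).2, (h 1).2, Matrix.mulVec_mulVec, ← Matrix.SpecialLinearGroup.coe_mul,
      ← List.prod_cons, ← List.map_cons] at this
    refine ⟨this.1, this.2.trans ?_⟩
    ring

open Polynomial in
/-- For a prime `p ≥ 5` the pair `genPair`, as a pair of functions from `𝔽_p` to `SL₂(𝔽_p)`,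
satisfies no relation of length less than `p`: a nontrivial word of length `n` has an entry which is
a nonconstant polynomial of degree at most `n` in the parameter. -/
theorem lift_genPair_ne_one {p : ℕ} [Fact p.Prime] (hp : 5 ≤ p) (w : FreeGroup (Fin 2))
    (hw : w ≠ 1) (hwp : w.norm < p) :
    FreeGroup.lift (fun i (r : ZMod p) => genPair r i) w ≠ 1 := by
  intro hone
  have h2 : (2 : ZMod p) ≠ 0 := by
    intro h
    have := (ZMod.natCast_eq_zero_iff 2 p).1 (by exact_mod_cast h)
    exact absurd (Nat.le_of_dvd (by norm_num) this) (by omega)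
  have h3 : (3 : ZMod p) ≠ 0 := by
    intro h
    have := (ZMod.natCast_eq_zero_iff 3 p).1 (by exact_mod_cast h)
    exact absurd (Nat.le_of_dvd (by norm_num) this) (by omega)
  obtain ⟨c, L, hcL⟩ : ∃ c L, w.toWord = c :: L :=
    List.exists_cons_of_ne_nil (mt FreeGroup.toWord_eq_nil_iff.1 hw)
  have hred : FreeGroup.IsReduced (c :: L) := hcL ▸ FreeGroup.isReduced_toWord
  have hlen : L.length + 1 < p := by
    rw [FreeGroup.norm, hcL] at hwp
    simpa using hwp
  obtain ⟨s, hs, h⟩ := natDegree_coeff_prod_mulVec h2 h3 c L hred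
  set v := ((c :: L).map (polyLetter (ZMod p))).prod.1.mulVec ![1, 3] with hv
  have hprod : ((c :: L).map (polyLetter (ZMod p))).prod =
      FreeGroup.lift (genPair (X : (ZMod p)[X])) w := by
    rw [← FreeGroup.mk_toWord (x := w), hcL, FreeGroup.lift_mk]
    rfl
  -- All specializations of the word are trivial.
  have heval : ∀ r : ZMod p, Matrix.SpecialLinearGroup.map (evalRingHom r)
      (FreeGroup.lift (genPair (X : (ZMod p)[X])) w) = 1 := by
    intro r
    have e1 : (Matrix.SpecialLinearGroup.map (evalRingHom r)).comp
        (FreeGroup.lift (genPair (X : (ZMod p)[X]))) =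
        (Pi.evalMonoidHom (fun _ : ZMod p => Matrix.SpecialLinearGroup (Fin 2) (ZMod p)) r).comp
          (FreeGroup.lift (fun i (r : ZMod p) => genPair r i)) := by
      ext i : 1
      simp only [MonoidHom.comp_apply, FreeGroup.lift_apply_of, Pi.evalMonoidHom_apply]
      ext a b
      change ((genPair (X : (ZMod p)[X]) i).1.map (evalRingHom r)) a b = _
      fin_cases i <;> fin_cases a <;> fin_cases b <;> simp [genPair]
    have e2 := DFunLike.congr_fun e1 w
    simp only [MonoidHom.comp_apply, hone, map_one] at e2
    exact e2
  have hconst : ∀ i, v i = C (![1, 3] i) := by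
    intro i
    rw [← sub_eq_zero]
    refine eq_zero_of_natDegree_lt_card_of_eval_eq_zero _ Function.injective_id (fun r => ?_) ?_
    · have h1 : ((FreeGroup.lift (genPair (X : (ZMod p)[X])) w).1.map (evalRingHom r)) = 1 :=
        congrArg Subtype.val (heval r)
      have h4 : eval r (v i) = (1 : Matrix (Fin 2) (Fin 2) (ZMod p)).mulVec ![1, 3] i := by
        rw [← h1, hv, hprod]
        simp [Matrix.mulVec, dotProduct, Fin.sum_univ_two]
      rw [id, eval_sub, eval_C, h4, Matrix.one_mulVec, sub_self]
    · rw [ZMod.card]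
      refine (natDegree_sub_C (p := v i)).trans_lt ?_
      exact (h i).1.trans_lt hlen
  have hzero : ∀ i, leadVec (ZMod p) c i = 0 := by
    intro i
    have := (h i).2
    rw [hconst, coeff_C_succ] at this
    exact (mul_eq_zero.1 this.symm).resolve_right hs
  have h0 := hzero 0
  have h1 := hzero 1
  obtain ⟨j, ε⟩ := c
  fin_cases j <;> cases ε <;> simp [leadVec] at h0 h1

end SL2

/-! ### Words in free groups -/

namespace FreeGroup

theorem norm_lift_le {α β : Type*} [DecidableEq α] [DecidableEq β] {f : α → FreeGroup β} {C : ℕ}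
    (hf : ∀ a, (f a).norm ≤ C) (w : FreeGroup α) : (lift f w).norm ≤ C * w.norm := by
  have h : lift f w = (w.toWord.map fun x => cond x.2 (f x.1) (f x.1)⁻¹).prod := by
    rw [← lift_mk, mk_toWord]
  rw [h, norm.eq_def w]
  generalize w.toWord = L
  induction L with
  | nil => simp
  | cons c L ih =>
    rw [List.map_cons, List.prod_cons, List.length_cons, Nat.mul_succ, add_comm]
    refine (norm_mul_le _ _).trans (add_le_add ?_ ih)
    cases c.2 <;> simp [hf]

/-- The action of `ℤ` on the free group on `ℤ` by translation of the basis. -/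
def translation : Multiplicative ℤ →* MulAut (FreeGroup ℤ) where
  toFun z := freeGroupCongr (Equiv.addLeft z.toAdd)
  map_one' := by
    apply MulEquiv.toMonoidHom_injective
    ext i
    simp
  map_mul' y z := by
    apply MulEquiv.toMonoidHom_injective
    ext i
    simp [add_assoc]

/-- The homomorphism from `F₂ = ⟨x, y⟩` to the semidirect product of the free group on `ℤ` with `ℤ`
which sends `x` to the translation by `1` and `y` to the basis element with index `0`. -/
def toTranslation : FreeGroup (Fin 2) →* FreeGroup ℤ ⋊[translation] Multiplicative ℤ :=
  lift ![SemidirectProduct.inr (Multiplicative.ofAdd 1), SemidirectProduct.inl (of 0)]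

theorem toTranslation_conj (i : ℕ) :
    toTranslation (of 0 ^ i * of 1 * (of 0 ^ i)⁻¹) = SemidirectProduct.inl (of (i : ℤ)) := by
  have h : toTranslation (of 0 ^ i) = SemidirectProduct.inr (Multiplicative.ofAdd (i : ℤ)) := by
    rw [_root_.map_pow, toTranslation, lift_apply_of, Matrix.cons_val_zero, ← _root_.map_pow]
    congr 1
    rw [← ofAdd_nsmul]
    simp
  rw [_root_.map_mul, _root_.map_mul, _root_.map_inv, h, ← _root_.map_inv]
  have h1 : toTranslation (of 1) = SemidirectProduct.inl (of 0) := by simp [toTranslation]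
  rw [h1, ← SemidirectProduct.inl_aut]
  simp [translation]

/-- The conjugates `xⁱ y x⁻ⁱ` freely generate a free group. -/
theorem lift_conj_injective (k : ℕ) :
    Function.Injective (lift fun i : Fin k =>
      (of 0 ^ (i : ℕ) * of 1 * (of 0 ^ (i : ℕ))⁻¹ : FreeGroup (Fin 2))) := by
  have h : toTranslation.comp (lift fun i : Fin k =>
      (of 0 ^ (i : ℕ) * of 1 * (of 0 ^ (i : ℕ))⁻¹ : FreeGroup (Fin 2))) =
      SemidirectProduct.inl.comp (map fun i : Fin k => ((i : ℕ) : ℤ)) := by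
    ext i : 1
    simp only [MonoidHom.comp_apply, lift_apply_of, toTranslation_conj, map.of]
  have hinj : Function.Injective (toTranslation.comp (lift fun i : Fin k =>
      (of 0 ^ (i : ℕ) * of 1 * (of 0 ^ (i : ℕ))⁻¹ : FreeGroup (Fin 2)))) := by
    rw [h]
    exact SemidirectProduct.inl_injective.comp
      (map_injective (Nat.cast_injective.comp Fin.val_injective))
  exact Function.Injective.of_comp hinj

/-- The commutator `[x, y]` and its conjugate by `x ^ 2`. -/
def commPair {α : Type*} (x y : α) : Fin 2 → FreeGroup α :=
  ![of x * of y * (of x)⁻¹ * (of y)⁻¹,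
    of x ^ 2 * (of x * of y * (of x)⁻¹ * (of y)⁻¹) * (of x ^ 2)⁻¹]

/-- The two elements `commPair 0 1` freely generate a free group: written as `c₁ * c₀⁻¹` and
`c₃ * c₂⁻¹` in the free elements `cᵢ = xⁱ y x⁻ⁱ`, they are free because killing `c₀` and `c₂`
leaves `c₁` and `c₃`. -/
theorem lift_commPair_injective : Function.Injective (lift (commPair (0 : Fin 2) 1)) := by
  have h : toTranslation.comp (lift (commPair (0 : Fin 2) 1)) =
      SemidirectProduct.inl.comp (lift ![of (1 : ℤ) * (of 0)⁻¹, of 3 * (of 2)⁻¹]) := by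
    have e (n : ℕ) := toTranslation_conj n
    ext i : 1
    simp only [MonoidHom.comp_apply, lift_apply_of]
    fin_cases i
    · have := congrArg₂ (· * ·⁻¹) (e 1) (e 0)
      simp only [← _root_.map_inv, ← _root_.map_mul] at this
      simp only [commPair]
      convert this using 2
      · simp
      · rfl
    · have := congrArg₂ (· * ·⁻¹) (e 3) (e 2)
      simp only [← _root_.map_inv, ← _root_.map_mul] at this
      simp only [commPair]
      convert this using 2
      · simp [pow_succ, mul_assoc]
      · rfl
  let ρ : FreeGroup ℤ →* FreeGroup (Fin 2) :=
    lift fun z => if z = 1 then of 0 else if z = 3 then of 1 else 1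
  have hρ : ρ.comp (lift ![of (1 : ℤ) * (of 0)⁻¹, of 3 * (of 2)⁻¹]) = MonoidHom.id _ := by
    ext i : 1
    fin_cases i <;> simp [ρ]
  have hinj : Function.Injective (lift ![of (1 : ℤ) * (of 0)⁻¹, of 3 * (of 2)⁻¹]) :=
    Function.LeftInverse.injective (g := ρ) fun w => DFunLike.congr_fun hρ w
  have hinj' : Function.Injective (toTranslation.comp (lift (commPair (0 : Fin 2) 1))) := by
    rw [h]
    exact SemidirectProduct.inl_injective.comp hinj
  exact Function.Injective.of_comp hinj'

theorem lift_commPair_ne_one {α : Type*} {x y : α} (hxy : x ≠ y) {w : FreeGroup (Fin 2)}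
    (hw : w ≠ 1) : lift (commPair x y) w ≠ 1 := by
  have h : lift (commPair x y) = (map ![x, y]).comp (lift (commPair (0 : Fin 2) 1)) := by
    ext i : 1
    fin_cases i <;> simp [commPair]
  rw [h, MonoidHom.comp_apply]
  have hinj : Function.Injective ![x, y] := by
    intro i j hij
    fin_cases i <;> fin_cases j <;> simp_all
  intro h1
  rw [← _root_.map_one (map ![x, y])] at h1
  have h2 := map_injective hinj h1
  rw [← _root_.map_one (lift (commPair (0 : Fin 2) 1))] at h2
  exact hw (lift_commPair_injective h2)

theorem norm_commPair_le {α : Type*} [DecidableEq α] (x y : α) (i : Fin 2) :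
    (commPair x y i).norm ≤ 8 := by
  have h0 : (of x * of y * (of x)⁻¹ * (of y)⁻¹).norm ≤ 4 :=
    norm_mk_le (L₁ := [(x, true), (y, true), (x, false), (y, false)])
  fin_cases i
  · exact h0.trans (by norm_num)
  · refine (norm_mul_le _ _).trans ?_
    have h1 := norm_mul_le (of x ^ 2) (of x * of y * (of x)⁻¹ * (of y)⁻¹)
    have h2 := norm_of_pow x 2
    rw [norm_inv_eq]
    omega

/-! ### Words which vanish on many pairs -/

/-- A conjugate of the commutator of `W` and `y * x ^ e * y⁻¹`, where `x` and `y` are the two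
generators. It vanishes where `W` or `x ^ e` does. The conjugation by
`x * y` makes its reduced form start and end with a power of `x` if that of `W` does. -/
def lawStep (W : FreeGroup (Fin 2)) (e : ℕ) : FreeGroup (Fin 2) :=
  of 0 * of 1 * (W * (of 1 * of 0 ^ e * (of 1)⁻¹) * W⁻¹ * (of 1 * of 0 ^ e * (of 1)⁻¹)⁻¹) *
    (of 0 * of 1)⁻¹

/-- A word which vanishes on all commuting pairs, and on all pairs whose first element has order
dividing a member of the list. -/
def lawWord : List ℕ → FreeGroup (Fin 2)
  | [] => lawStep (of 0) 1
  | e :: es => lawStep (lawWord es) e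

theorem norm_lawStep_le (W : FreeGroup (Fin 2)) (e : ℕ) :
    (lawStep W e).norm ≤ 2 * W.norm + 2 * e + 8 := by
  have h1 : (of 1 * of 0 ^ e * (of 1)⁻¹ : FreeGroup (Fin 2)).norm ≤ e + 2 := by
    have a1 := norm_mul_le (of 1 * of 0 ^ e) ((of 1)⁻¹ : FreeGroup (Fin 2))
    have a2 := norm_mul_le (of 1) (of 0 ^ e : FreeGroup (Fin 2))
    rw [norm_inv_eq, norm_of] at a1
    rw [norm_of, norm_of_pow] at a2
    omega
  have h2 : (of 0 * of 1 : FreeGroup (Fin 2)).norm ≤ 2 :=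
    norm_mk_le (L₁ := [((0 : Fin 2), true), (1, true)])
  unfold lawStep
  generalize (of 1 * of 0 ^ e * (of 1)⁻¹ : FreeGroup (Fin 2)) = V at *
  generalize (of 0 * of 1 : FreeGroup (Fin 2)) = U at *
  have b1 := norm_mul_le (U * (W * V * W⁻¹ * V⁻¹)) U⁻¹
  have b2 := norm_mul_le U (W * V * W⁻¹ * V⁻¹)
  have b3 := norm_mul_le (W * V * W⁻¹) V⁻¹
  have b4 := norm_mul_le (W * V) W⁻¹
  have b5 := norm_mul_le W V
  rw [norm_inv_eq] at b1 b3 b4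
  omega

theorem map_lawStep_of_left {G : Type*} [Group G] (π : FreeGroup (Fin 2) →* G)
    {W : FreeGroup (Fin 2)} (hW : π W = 1) (e : ℕ) : π (lawStep W e) = 1 := by
  simp [lawStep, hW]

theorem map_lawStep_of_right {G : Type*} [Group G] (π : FreeGroup (Fin 2) →* G)
    (W : FreeGroup (Fin 2)) {e : ℕ} (he : π (of 0) ^ e = 1) : π (lawStep W e) = 1 := by
  simp [lawStep, he]

theorem map_lawWord_of_mem {G : Type*} [Group G] (π : FreeGroup (Fin 2) →* G) {es : List ℕ} {e : ℕ}
    (h : e ∈ es) (he : π (of 0) ^ e = 1) : π (lawWord es) = 1 := by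
  induction es with
  | nil => simp at h
  | cons d es ih =>
    rcases List.mem_cons.1 h with rfl | h
    · exact map_lawStep_of_right π _ he
    · exact map_lawStep_of_left π (ih h) d

theorem map_lawWord_of_commute {G : Type*} [Group G] (π : FreeGroup (Fin 2) →* G)
    (h : Commute (π (of 0)) (π (of 1))) (es : List ℕ) : π (lawWord es) = 1 := by
  induction es with
  | nil =>
    have h1 : π (of 1) * π (of 0) * (π (of 1))⁻¹ = π (of 0) := by
      rw [← h.eq, mul_inv_cancel_right]
    simp only [lawWord, lawStep, _root_.map_mul, _root_.map_inv, pow_one, h1]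
    group
  | cons d es ih => exact map_lawStep_of_left π ih d

/-- The homomorphism from `F₂` to the free product of two infinite cyclic groups. -/
def toCoprod : FreeGroup (Fin 2) →* Monoid.CoprodI fun _ : Fin 2 => Multiplicative ℤ :=
  lift fun i => Monoid.CoprodI.of (i := i) (Multiplicative.ofAdd 1)

open Monoid.CoprodI in
/-- `lawStep` preserves the words whose reduced form starts and ends with a power of the first
generator; in particular it does not produce the trivial word. -/
theorem exists_neWord_lawStep {W : FreeGroup (Fin 2)} {e : ℕ} (he : e ≠ 0)
    (hW : ∃ u : NeWord (fun _ : Fin 2 => Multiplicative ℤ) 0 0, u.prod = toCoprod W) :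
    ∃ u : NeWord (fun _ : Fin 2 => Multiplicative ℤ) 0 0, u.prod = toCoprod (lawStep W e) := by
  obtain ⟨u, hu⟩ := hW
  have h01 : (0 : Fin 2) ≠ 1 := by decide
  let X : NeWord (fun _ : Fin 2 => Multiplicative ℤ) 0 0 :=
    .singleton (Multiplicative.ofAdd 1) (by decide)
  let Y : NeWord (fun _ : Fin 2 => Multiplicative ℤ) 1 1 :=
    .singleton (Multiplicative.ofAdd 1) (by decide)
  let Y2 : NeWord (fun _ : Fin 2 => Multiplicative ℤ) 1 1 :=
    .singleton (Multiplicative.ofAdd 2) (by decide)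
  let E : NeWord (fun _ : Fin 2 => Multiplicative ℤ) 0 0 :=
    .singleton (Multiplicative.ofAdd (e : ℤ)) (by simpa using he)
  -- The reduced form is `x y W y xᵉ y⁻¹ W⁻¹ y x⁻ᵉ y⁻² x⁻¹`.
  refine ⟨X.append h01 <| Y.append h01.symm <| u.append h01 <| Y.append h01.symm <| E.append h01 <|
    Y.inv.append h01.symm <| u.inv.append h01 <| Y.append h01.symm <| E.inv.append h01 <|
    Y2.inv.append h01.symm X.inv, ?_⟩
  have hX : X.prod = toCoprod (of 0) := by simp [X, toCoprod]
  have hY : Y.prod = toCoprod (of 1) := by simp [Y, toCoprod]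
  have hE : E.prod = toCoprod (of 0) ^ e := by
    simp only [E, toCoprod, NeWord.prod_singleton, lift_apply_of, ← _root_.map_pow]
    congr 1
    rw [← ofAdd_nsmul]
    simp
  have hY2 : Y2.prod = toCoprod (of 1) ^ 2 := by
    simp only [Y2, toCoprod, NeWord.prod_singleton, lift_apply_of, ← _root_.map_pow]
    congr 1
  simp only [NeWord.append_prod, NeWord.inv_prod, hX, hY, hE, hY2, hu, lawStep,
    _root_.map_mul, _root_.map_inv,
    _root_.map_pow]
  group

theorem lawWord_ne_one {es : List ℕ} (h : ∀ e ∈ es, e ≠ 0) : lawWord es ≠ 1 := by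
  have key : ∃ u : Monoid.CoprodI.NeWord (fun _ : Fin 2 => Multiplicative ℤ) 0 0,
      u.prod = toCoprod (lawWord es) := by
    induction es with
    | nil =>
      exact exists_neWord_lawStep one_ne_zero
        ⟨.singleton (Multiplicative.ofAdd 1) (by decide), by simp [toCoprod]⟩
    | cons e es ih =>
      exact exists_neWord_lawStep (h e (by simp)) (ih fun d hd => h d (by simp [hd]))
  obtain ⟨u, hu⟩ := key
  intro h1
  rw [h1, _root_.map_one] at hu
  have h2 : u.toWord = Monoid.CoprodI.Word.empty := Monoid.CoprodI.Word.equiv.symm.injective hu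
  exact u.toList_ne_nil (congrArg Monoid.CoprodI.Word.toList h2)

end FreeGroup

/-! ### A group of lamplighter type -/

namespace Lamplighter

open SemidirectProduct

variable {H : ℕ → Type} [∀ j, Group (H j)]

/-- The translation action of `ℤ` on the families indexed by `ℕ × ℤ`. -/
def shift (H : ℕ → Type) [∀ j, Group (H j)] : Multiplicative ℤ →* MulAut (∀ j, ℤ → H j) where
  toFun z :=
    { toFun := fun f j m => f j (m - z.toAdd)
      invFun := fun f j m => f j (m + z.toAdd)
      left_inv := fun f => by ext j m; simp
      right_inv := fun f => by ext j m; simp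
      map_mul' := fun f f' => rfl }
  map_one' := by ext f j m; simp
  map_mul' y z := by
    ext f j m
    simp only [MulAut.mul_apply, MulEquiv.coe_mk, Equiv.coe_fn_mk, toAdd_mul]
    congr 1
    ring

@[simp]
theorem shift_apply (z : Multiplicative ℤ) (f : ∀ j, ℤ → H j) (j : ℕ) (m : ℤ) :
    shift H z f j m = f j (m - z.toAdd) :=
  rfl

@[simp]
theorem shift_symm_apply (z : Multiplicative ℤ) (f : ∀ j, ℤ → H j) (j : ℕ) (m : ℤ) :
    (shift H z).symm f j m = f j (m + z.toAdd) :=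
  rfl

/-- The element of the base group whose component with index `(j, m)` is `a j` if `m = n j`, and
trivial otherwise. -/
def lamp (a : ∀ j, H j) (n : ℕ → ℤ) : ∀ j, ℤ → H j :=
  fun j m => if m = n j then a j else 1

/-- The generators: the translation, the element with components `c j 0` at `(j, 0)`, and the
element with components `c j 1` at `(j, n j)`. -/
def gens (c : ∀ j, Fin 2 → H j) (n : ℕ → ℕ) :
    Set ((∀ j, ℤ → H j) ⋊[shift H] Multiplicative ℤ) :=
  {inr (Multiplicative.ofAdd 1), inl (lamp (fun j => c j 0) fun _ => 0),
    inl (lamp (fun j => c j 1) fun j => n j)}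

/-- The subgroup generated by `gens c n`. -/
abbrev lampGroup (c : ∀ j, Fin 2 → H j) (n : ℕ → ℕ) :
    Subgroup ((∀ j, ℤ → H j) ⋊[shift H] Multiplicative ℤ) :=
  Subgroup.closure (gens c n)

/-- The elements of `gens c n`, as elements of the group they generate. -/
def genSet (c : ∀ j, Fin 2 → H j) (n : ℕ → ℕ) : Set (lampGroup c n) :=
  Subtype.val ⁻¹' gens c n

variable {c : ∀ j, Fin 2 → H j} {n : ℕ → ℕ}

theorem finite_genSet : (genSet c n).Finite :=
  Set.Finite.preimage Subtype.val_injective.injOn (by simp [gens])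

theorem closure_genSet : Subgroup.closure (genSet c n) = ⊤ :=
  Subgroup.closure_closure_coe_preimage

/-- The case of a single generator, or its inverse, of the locality lemma `left_mem_zpowers`. -/
theorem letter_spec {x : (∀ j, ℤ → H j) ⋊[shift H] Multiplicative ℤ}
    (hx : x ∈ gens c n ∨ x⁻¹ ∈ gens c n) :
    |x.right.toAdd| ≤ 1 ∧ ∀ j m, (m ≠ 0 → x.left j m ∈ Subgroup.zpowers (c j 1)) ∧
      (m ≠ n j → x.left j m ∈ Subgroup.zpowers (c j 0)) := by
  have key : ∀ y ∈ gens c n, y = inr (Multiplicative.ofAdd 1) ∨ (y.right = 1 ∧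
      ∀ j m, (m ≠ 0 → y.left j m ∈ Subgroup.zpowers (c j 1)) ∧
        (m ≠ n j → y.left j m ∈ Subgroup.zpowers (c j 0))) := by
    rintro y (rfl | rfl | rfl)
    · exact Or.inl rfl
    · refine Or.inr ⟨rfl, fun j m => ⟨fun h => ?_, fun h => ?_⟩⟩
      · simp [lamp, h]
      · by_cases h0 : m = 0 <;> simp [lamp, h0]
    · refine Or.inr ⟨rfl, fun j m => ⟨fun h => ?_, fun h => ?_⟩⟩
      · by_cases h0 : m = n j <;> simp [lamp, h0]
      · simp [lamp, h]
  rcases hx with hx | hx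
  · rcases key x hx with rfl | ⟨h1, h2⟩
    · simp
    · exact ⟨by simp [h1], h2⟩
  · rcases key _ hx with h | ⟨h1, h2⟩
    · rw [inv_eq_iff_eq_inv] at h
      subst h
      simp
    · have h1' : x.right = 1 := by simpa using h1
      refine ⟨by simp [h1'], fun j m => ?_⟩
      have h3 : x⁻¹.left j m = (x.left j m)⁻¹ := by simp [h1']
      have h4 := h2 j m
      rw [h3, inv_mem_iff, inv_mem_iff] at h4
      exact h4

/-- Locality: a product of `R` generators has the component with index `(j, m)` in the cyclic
group generated by `c j 1` if `m` is further than `R` from `0`, and in the cyclic group generated by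
`c j 0` if `m` is further than `R` from `n j`. -/
theorem left_mem_zpowers {R : ℕ} {γ : (∀ j, ℤ → H j) ⋊[shift H] Multiplicative ℤ}
    (hγ : HasLengthLE (gens c n) R γ) (j : ℕ) (m : ℤ) :
    ((R : ℤ) < |m| → γ.left j m ∈ Subgroup.zpowers (c j 1)) ∧
      ((R : ℤ) < |m - n j| → γ.left j m ∈ Subgroup.zpowers (c j 0)) := by
  obtain ⟨l, hl, rfl, hlR⟩ := hγ
  induction l generalizing R m with
  | nil => simp
  | cons x l ih =>
    obtain ⟨R, rfl⟩ : ∃ R', R = R' + 1 := ⟨R - 1, by simp at hlR; omega⟩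
    obtain ⟨hx1, hx2⟩ := letter_spec (hl x (by simp))
    have ih' := ih (R := R) (m := m - x.right.toAdd) (fun y hy => hl y (by simp [hy]))
      (by simpa using hlR)
    rw [List.prod_cons, mul_left, Pi.mul_apply, Pi.mul_apply, shift_apply]
    rw [abs_le] at hx1
    push_cast
    constructor
    · intro hm
      refine mul_mem ((hx2 j m).1 ?_) (ih'.1 ?_)
      · rintro rfl
        simp at hm
        omega
      · rw [lt_abs] at hm ⊢
        omega
    · intro hm
      refine mul_mem ((hx2 j m).2 ?_) (ih'.2 ?_)
      · rintro rfl
        simp at hm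
        omega
      · rw [lt_abs] at hm ⊢
        omega

theorem commute_of_mem_zpowers {G : Type*} [Group G] {a x y : G} (hx : x ∈ Subgroup.zpowers a)
    (hy : y ∈ Subgroup.zpowers a) : Commute x y := by
  obtain ⟨i, rfl⟩ := Subgroup.mem_zpowers_iff.1 hx
  obtain ⟨k, rfl⟩ := Subgroup.mem_zpowers_iff.1 hy
  exact (Commute.refl a).zpow_zpow i k

/-- The components of two products of `R` generators commute, except possibly at the places `(j, m)`
with `|m| ≤ R` and `n j ≤ 2 * R`. -/
theorem commute_left {R : ℕ} {γ γ' : (∀ j, ℤ → H j) ⋊[shift H] Multiplicative ℤ}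
    (hγ : HasLengthLE (gens c n) R γ) (hγ' : HasLengthLE (gens c n) R γ') {j : ℕ} {m : ℤ}
    (h : (R : ℤ) < |m| ∨ 2 * R < n j) : Commute (γ.left j m) (γ'.left j m) := by
  by_cases hm : (R : ℤ) < |m|
  · exact commute_of_mem_zpowers ((left_mem_zpowers hγ j m).1 hm) ((left_mem_zpowers hγ' j m).1 hm)
  · have hm' : (R : ℤ) < |m - n j| := by
      have hR := h.resolve_left hm
      rw [not_lt, abs_le] at hm
      rw [lt_abs]
      omega
    exact commute_of_mem_zpowers ((left_mem_zpowers hγ j m).2 hm')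
      ((left_mem_zpowers hγ' j m).2 hm')

theorem exists_hasLengthLE (γ : lampGroup c n) :
    ∃ R, HasLengthLE (gens c n) R (γ : (∀ j, ℤ → H j) ⋊[shift H] Multiplicative ℤ) :=
  HasLengthLE.exists_of_mem_closure γ.2

/-! ### Elementary amenability of the group -/

/-- The projection of the group to `ℤ`. -/
def toInt (c : ∀ j, Fin 2 → H j) (n : ℕ → ℕ) : lampGroup c n →* Multiplicative ℤ :=
  rightHom.comp (lampGroup c n).subtype

theorem toInt_surjective : Function.Surjective (toInt c n) := by
  intro z
  refine ⟨⟨inr (Multiplicative.ofAdd 1), Subgroup.subset_closure (by simp [gens])⟩ ^ z.toAdd, ?_⟩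
  rw [map_zpow]
  change Multiplicative.ofAdd (1 : ℤ) ^ z.toAdd = z
  rw [← ofAdd_zsmul]
  simp

/-- The components of the elements of the kernel of the projection to `ℤ`. -/
def components (c : ∀ j, Fin 2 → H j) (n : ℕ → ℕ) :
    (toInt c n).ker →* ∀ i : ℕ × ℤ, H i.1 where
  toFun x i := x.1.1.left i.1 i.2
  map_one' := rfl
  map_mul' x y := by
    have hx : x.1.1.right = 1 := x.2
    ext i
    simp [hx]

theorem components_injective : Function.Injective (components c n) := by
  intro x y hxy
  have hx : x.1.1.right = 1 := x.2
  have hy : y.1.1.right = 1 := y.2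
  apply Subtype.ext
  apply Subtype.ext
  ext j m
  · exact congrFun hxy (j, m)
  · rw [hx, hy]

/-- The families with finite support. -/
def finSupport (H : ℕ → Type) [∀ j, Group (H j)] : Subgroup (∀ i : ℕ × ℤ, H i.1) where
  carrier := {f | {i | f i ≠ 1}.Finite}
  one_mem' := by simp
  mul_mem' {f f'} hf hf' := by
    refine (hf.union hf').subset fun i hi => ?_
    by_contra h
    simp only [Set.mem_union, Set.mem_ofPred_eq, not_or, not_not] at h
    exact hi (by rw [Pi.mul_apply, h.1, h.2, mul_one])
  inv_mem' {f} hf := by simpa using hf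

/-- Locality makes the commutators of elements of the kernel of the projection to `ℤ` finitely
supported. -/
theorem commutator_le (hn : ∀ R, {j | n j ≤ R}.Finite) :
    commutator (toInt c n).ker ≤ (finSupport H).comap (components c n) := by
  rw [commutator_def, Subgroup.commutator_le]
  intro x _ y _
  obtain ⟨R, hR⟩ := exists_hasLengthLE x.1
  obtain ⟨R', hR'⟩ := exists_hasLengthLE y.1
  replace hR := hR.mono (le_max_left R R')
  replace hR' := hR'.mono (le_max_right R R')
  set N := max R R'
  rw [Subgroup.mem_comap, map_commutatorElement]
  refine ((hn (2 * N)).prod (Set.finite_Icc (-(N : ℤ)) N)).subset fun i hi => ?_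
  by_contra h
  refine hi ?_
  have hcomm : Commute (components c n x i) (components c n y i) := by
    refine commute_left hR hR' ?_
    rw [Set.mem_prod, Set.mem_Icc, ← abs_le, Set.mem_ofPred_eq] at h
    omega
  exact commutatorElement_eq_one_iff_commute.2 hcomm

/-- The group is an extension of a locally finite group by an abelian group, extended by `ℤ`. -/
theorem isElementaryAmenable [∀ j, Finite (H j)] (hn : ∀ R, {j | n j ≤ R}.Finite) :
    IsElementaryAmenable (lampGroup c n) := by
  refine .extension (toInt c n) toInt_surjective ?_ .multiplicative_int
  refine .extension (Abelianization.of (G := (toInt c n).ker)) QuotientGroup.mk_surjective ?_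
    (.of_commGroup _)
  refine .of_finite_support ((components c n).comp (MonoidHom.ker _).subtype)
    (components_injective.comp Subtype.val_injective) fun g => ?_
  exact commutator_le hn (Abelianization.ker_of (toInt c n).ker ▸ g.2)

/-! ### The lawlessness growth of the group -/

theorem lift_eq_inl {α : Type*} (Z : α → lampGroup c n) (hZ : ∀ i, (Z i).1.right = 1)
    (w : FreeGroup α) :
    ((FreeGroup.lift Z w : lampGroup c n) : (∀ j, ℤ → H j) ⋊[shift H] Multiplicative ℤ) =
      inl (FreeGroup.lift (fun i => (Z i).1.left) w) := by
  have h : (lampGroup c n).subtype.comp (FreeGroup.lift Z) =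
      inl.comp (FreeGroup.lift fun i => (Z i).1.left) := by
    ext i : 1
    simp only [MonoidHom.comp_apply, FreeGroup.lift_apply_of, Subgroup.subtype_apply]
    ext j m
    · rfl
    · simp [hZ i]
  exact DFunLike.congr_fun h w

theorem left_lift_apply {α : Type*} (Z : α → lampGroup c n) (hZ : ∀ i, (Z i).1.right = 1)
    (w : FreeGroup α) (j : ℕ) (m : ℤ) :
    (FreeGroup.lift Z w).1.left j m = FreeGroup.lift (fun i => (Z i).1.left j m) w := by
  rw [lift_eq_inl Z hZ, left_inl]
  have h : ((Pi.evalMonoidHom _ m).comp (Pi.evalMonoidHom (fun j => ℤ → H j) j)).comp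
      (FreeGroup.lift fun i => (Z i).1.left) = FreeGroup.lift fun i => (Z i).1.left j m := by
    ext i : 1
    simp
  exact DFunLike.congr_fun h w

/-- Short elements on which a given word is not trivial: the two elements
`a = lamp (c · 0)` and `t ^ (-n j) * b * t ^ n j` have the components `c j 0` and `c j 1` at the
place `(j, 0)`, so that words in them detect what does not vanish on words in `c j 0` and
`c j 1`. -/
theorem exists_lift_ne_one {k : ℕ} {w : FreeGroup (Fin k)} (hw : w ≠ 1) (j : ℕ)
    (hj : ∀ v : FreeGroup (Fin 2), v ≠ 1 → v.norm ≤ (2 * k + 1) * w.norm →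
      FreeGroup.lift (c j) v ≠ 1) :
    ∃ g : Fin k → lampGroup c n,
      (∀ i, HasLengthLE (genSet c n) (2 * k + 2 * n j + 1) (g i)) ∧ FreeGroup.lift g w ≠ 1 := by
  let t : lampGroup c n := ⟨inr (Multiplicative.ofAdd 1), Subgroup.subset_closure (by simp [gens])⟩
  let a : lampGroup c n := ⟨inl (lamp (fun j => c j 0) fun _ => 0),
    Subgroup.subset_closure (by simp [gens])⟩
  let b : lampGroup c n := ⟨inl (lamp (fun j => c j 1) fun j => n j),
    Subgroup.subset_closure (by simp [gens])⟩
  have ht : HasLengthLE (genSet c n) 1 t := .of_mem (by simp [genSet, t, gens])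
  have ha : HasLengthLE (genSet c n) 1 a := .of_mem (by simp [genSet, a, gens])
  have hb : HasLengthLE (genSet c n) 1 b := .of_mem (by simp [genSet, b, gens])
  let Z : Fin 2 → lampGroup c n := ![a, (t ^ n j)⁻¹ * b * t ^ n j]
  have htn : ((t ^ n j : lampGroup c n) : (∀ j, ℤ → H j) ⋊[shift H] Multiplicative ℤ) =
      inr (Multiplicative.ofAdd (n j : ℤ)) := by
    rw [Subgroup.coe_pow, ← map_pow, ← ofAdd_nsmul]
    simp
  have hZ : ∀ i, (Z i).1.right = 1 := by
    intro i
    fin_cases i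
    · rfl
    · simp [Z, htn, b]
  have hZj : (fun i => (Z i).1.left j 0) = c j := by
    ext i
    fin_cases i
    · simp [Z, a, lamp]
    · simp [Z, htn, b, lamp]
  let v : Fin k → FreeGroup (Fin 2) := fun i =>
    .of 0 ^ (i : ℕ) * .of 1 * (.of 0 ^ (i : ℕ))⁻¹
  refine ⟨fun i => FreeGroup.lift Z (v i), fun i => ?_, fun h => ?_⟩
  · have h1 : FreeGroup.lift Z (v i) =
        a ^ (i : ℕ) * ((t ^ n j)⁻¹ * b * t ^ n j) * (a ^ (i : ℕ))⁻¹ := by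
      simp [v, Z]
    have hi := i.2
    simp only [h1]
    exact (((ha.pow i).mul (((ht.pow (n j)).inv.mul hb).mul (ht.pow (n j)))).mul
      (ha.pow i).inv).mono (by omega)
  · have h2 : FreeGroup.lift (fun i => FreeGroup.lift Z (v i)) w =
        FreeGroup.lift Z (FreeGroup.lift v w) := by
      have : FreeGroup.lift (fun i => FreeGroup.lift Z (v i)) =
          (FreeGroup.lift Z).comp (FreeGroup.lift v) := by
        ext i : 1
        simp
      exact DFunLike.congr_fun this w
    have h3 : FreeGroup.lift v w ≠ 1 := by
      intro h0
      rw [← map_one (FreeGroup.lift v)] at h0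
      exact hw (FreeGroup.lift_conj_injective k h0)
    refine hj _ h3 (FreeGroup.norm_lift_le (fun i => ?_) w) ?_
    · have e1 := FreeGroup.norm_mul_le (.of 0 ^ (i : ℕ) * .of 1 : FreeGroup (Fin 2))
        (.of 0 ^ (i : ℕ))⁻¹
      have e2 := FreeGroup.norm_mul_le (.of 0 ^ (i : ℕ)) (.of 1 : FreeGroup (Fin 2))
      rw [FreeGroup.norm_inv_eq, FreeGroup.norm_of_pow] at e1
      rw [FreeGroup.norm_of_pow, FreeGroup.norm_of] at e2
      have hi := i.2
      change FreeGroup.norm (.of 0 ^ (i : ℕ) * .of 1 * (.of 0 ^ (i : ℕ))⁻¹ : FreeGroup (Fin 2)) ≤ _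
      omega
    · rw [← hZj, ← left_lift_apply Z hZ, ← h2, h]
      rfl

/-- Let `u` be a word in two letters which vanishes on commuting pairs, and which is a law for the
groups `H j` with `n j ≤ 16 * R`. Then `u`, evaluated at `commPair`, vanishes on all elements of
length at most `R`: the components of the values of `commPair` at the other places commute. -/
theorem lift_commPair_eq_one {R : ℕ} {u : FreeGroup (Fin 2)}
    (hcomm : ∀ j, ∀ π : FreeGroup (Fin 2) →* H j, Commute (π (.of 0)) (π (.of 1)) → π u = 1)
    (hlaw : ∀ j, n j ≤ 16 * R → ∀ π : FreeGroup (Fin 2) →* H j, π u = 1)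
    {α : Type*} (x y : α) (g : α → lampGroup c n)
    (hg : ∀ i, HasLengthLE (genSet c n) R (g i)) :
    FreeGroup.lift g (FreeGroup.lift (FreeGroup.commPair x y) u) = 1 := by
  let Z : Fin 2 → lampGroup c n := fun i => FreeGroup.lift g (FreeGroup.commPair x y i)
  have h1 : FreeGroup.lift g (FreeGroup.lift (FreeGroup.commPair x y) u) =
      FreeGroup.lift Z u := by
    have : (FreeGroup.lift g).comp (FreeGroup.lift (FreeGroup.commPair x y)) =
        FreeGroup.lift Z := by
      ext i : 1
      simp [Z]
    exact DFunLike.congr_fun this u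
  have hZ : ∀ i, (Z i).1.right = 1 := by
    intro i
    have h2 : ∀ γ : lampGroup c n, γ.1.right = toInt c n γ := fun _ => rfl
    rw [h2]
    fin_cases i <;> simp [Z, FreeGroup.commPair, mul_comm]
  have hlen : ∀ i, HasLengthLE (gens c n) (8 * R) (Z i).1 := by
    intro i
    have key : HasLengthLE (genSet c n) (8 * R) (Z i) := by
      have h4 := ((((hg x).mul (hg y)).mul (hg x).inv).mul (hg y).inv)
      fin_cases i
      · have : Z 0 = g x * g y * (g x)⁻¹ * (g y)⁻¹ := by simp [Z, FreeGroup.commPair]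
        change HasLengthLE _ _ (Z 0)
        rw [this]
        exact h4.mono (by omega)
      · have : Z 1 = g x ^ 2 * (g x * g y * (g x)⁻¹ * (g y)⁻¹) * (g x ^ 2)⁻¹ := by
          simp [Z, FreeGroup.commPair]
        change HasLengthLE _ _ (Z 1)
        rw [this]
        exact ((((hg x).pow 2).mul h4).mul ((hg x).pow 2).inv).mono (by omega)
    exact key.map (lampGroup c n).subtype fun _ h => h
  rw [h1]
  apply Subtype.ext
  rw [lift_eq_inl Z hZ, ← left_inl (φ := shift H) (FreeGroup.lift (fun i => (Z i).1.left) u),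
    ← lift_eq_inl Z hZ]
  have : (FreeGroup.lift Z u).1.left = 1 := by
    ext j m
    rw [left_lift_apply Z hZ, Pi.one_apply, Pi.one_apply]
    by_cases hj : n j ≤ 16 * R
    · exact hlaw j hj _
    · refine hcomm j _ ?_
      rw [FreeGroup.lift_apply_of, FreeGroup.lift_apply_of]
      exact commute_left (hlen 0) (hlen 1) (Or.inr (by omega))
  rw [this]
  simp

end Lamplighter

/-! ### The choice of the parameters -/

namespace Lamplighter

/-- The functions from `𝔽_p` to `SL₂(𝔽_p)`, for the members `p` of a sequence. -/
abbrev Fiber (p : ℕ → ℕ) (j : ℕ) : Type :=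
  ZMod (p j) → Matrix.SpecialLinearGroup (Fin 2) (ZMod (p j))

/-- The pair of functions `SL2.genPair`. -/
def fiberGen (p : ℕ → ℕ) (j : ℕ) : Fin 2 → Fiber p j :=
  fun i r => SL2.genPair r i

/-- Exponents such that each element of each of the groups `SL₂(𝔽_{p i})`, `i ≤ j`, is killed by one
of them. -/
def exponents (p : ℕ → ℕ) : ℕ → List ℕ
  | 0 => [p 0 - 1, p 0 + 1, 2 * p 0]
  | j + 1 => (p (j + 1) - 1) :: (p (j + 1) + 1) :: (2 * p (j + 1)) :: exponents p j

variable {p n : ℕ → ℕ}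

theorem mem_exponents {i j : ℕ} (hij : i ≤ j) :
    p i - 1 ∈ exponents p j ∧ p i + 1 ∈ exponents p j ∧ 2 * p i ∈ exponents p j := by
  induction j with
  | zero =>
    obtain rfl : i = 0 := by omega
    simp [exponents]
  | succ j ih =>
    rcases Nat.lt_or_ge j i with h | h
    · obtain rfl : i = j + 1 := by omega
      simp [exponents]
    · obtain ⟨h1, h2, h3⟩ := ih h
      simp [exponents, h1, h2, h3]

theorem ne_zero_of_mem_exponents (hp : ∀ j, 5 ≤ p j) (j : ℕ) : ∀ e ∈ exponents p j, e ≠ 0 := by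
  induction j with
  | zero =>
    have := hp 0
    simp only [exponents, List.mem_cons, List.not_mem_nil, or_false]
    omega
  | succ j ih =>
    have := hp (j + 1)
    simp only [exponents, List.mem_cons]
    rintro e (h | h | h | h)
    · omega
    · omega
    · omega
    · exact ih e h

open FreeGroup in
/-- The laws have length linear in the largest prime: each prime contributes linearly and multiplies
the length of what precedes by `8`, which the growth of the sequence makes up for. -/
theorem norm_lawWord_exponents_le (hp : ∀ j, 5 ≤ p j) (hp' : ∀ j, 16 * p j ≤ p (j + 1)) (j : ℕ) :
    (lawWord (exponents p j)).norm ≤ 60 * p j := by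
  have step (q : ℕ) (es : List ℕ) : (lawWord ((q - 1) :: (q + 1) :: (2 * q) :: es)).norm ≤
      8 * (lawWord es).norm + 22 * q + 60 := by
    have h1 := norm_lawStep_le (lawWord es) (2 * q)
    have h2 := norm_lawStep_le (lawWord ((2 * q) :: es)) (q + 1)
    have h3 := norm_lawStep_le (lawWord ((q + 1) :: (2 * q) :: es)) (q - 1)
    simp only [lawWord] at *
    omega
  induction j with
  | zero =>
    have h0 : (lawWord []).norm ≤ 12 := by
      have := norm_lawStep_le (of 0) 1
      rwa [norm_of] at this
    have h1 := step (p 0) []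
    have h2 := hp 0
    simp only [exponents]
    omega
  | succ j ih =>
    have h1 := step (p (j + 1)) (exponents p j)
    have h2 := hp (j + 1)
    have h3 := hp' j
    simp only [exponents]
    omega

variable [∀ j, Fact (p j).Prime]

/-- The word for the exponents of `p 0, …, p j` is a law for the fibers with index at most `j`. -/
theorem map_lawWord_fiber {i j : ℕ} (hij : i ≤ j) (π : FreeGroup (Fin 2) →* Fiber p i) :
    π (FreeGroup.lawWord (exponents p j)) = 1 := by
  obtain ⟨h1, h2, h3⟩ := mem_exponents (p := p) hij
  funext r
  have key : ∀ e ∈ exponents p j, π (.of 0) r ^ e = 1 →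
      π (FreeGroup.lawWord (exponents p j)) r = 1 := fun e he h =>
    FreeGroup.map_lawWord_of_mem ((Pi.evalMonoidHom _ r).comp π) he h
  rcases SL2.pow_eq_one (π (.of 0) r) with h | h | h
  · exact key _ h1 h
  · exact key _ h2 h
  · exact key _ h3 h

theorem exists_lift_fiber_ne_one (hp : ∀ j, 5 ≤ p j) {k : ℕ} {w : FreeGroup (Fin k)} (hw : w ≠ 1)
    {j : ℕ} (hj : (2 * k + 1) * w.norm < p j) :
    ∃ g : Fin k → lampGroup (fiberGen p) n,
      (∀ i, HasLengthLE (genSet (fiberGen p) n) (2 * k + 2 * n j + 1) (g i)) ∧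
        FreeGroup.lift g w ≠ 1 :=
  exists_lift_ne_one hw j fun v hv hvn => SL2.lift_genPair_ne_one (hp j) v hv (hvn.trans_lt hj)

theorem isLawless (hp : ∀ j, 5 ≤ p j) (hp' : StrictMono p) :
    IsLawless (lampGroup (fiberGen p) n) := by
  rintro k w ⟨hw, hlaw⟩
  obtain ⟨g, -, hg⟩ := exists_lift_fiber_ne_one (n := n) hp hw
    (j := (2 * k + 1) * w.norm + 1) (hp'.le_apply)
  exact hg (hlaw _)

/-- If `p j` exceeds a multiple of `l`, then words of length `l` are detected at the place `(j, 0)`,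
by elements of length linear in `n j`. -/
theorem lawlessnessGrowth_le (hp : ∀ j, 5 ≤ p j) {k j : ℕ} {l : ℕ+} (hj : (2 * k + 1) * l < p j) :
    lawlessnessGrowth (genSet (fiberGen p) n) k l ≤ ((k * (2 * k + 2 * n j + 1) : ℕ) : ℕ∞) := by
  refine iSup₂_le fun w hw => ?_
  obtain ⟨g, hg, hgw⟩ := exists_lift_fiber_ne_one (n := n) hp hw.1
    ((Nat.mul_le_mul_left _ hw.2).trans_lt hj)
  exact wordComplexity_le g hg hgw

/-- The law for the fibers with index at most `i` is not detected by elements which are short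
compared to `n (i + 1)`, and its length is linear in `p i`. -/
theorem le_lawlessnessGrowth (hp : ∀ j, 5 ≤ p j) (hp' : ∀ j, 16 * p j ≤ p (j + 1))
    (hn : StrictMono n) {k : ℕ} (hk : 2 ≤ k) {i R : ℕ} (hR : 16 * R < n (i + 1)) {l : ℕ+}
    (hl : 480 * p i ≤ l) :
    (R : ℕ∞) + 1 ≤ lawlessnessGrowth (genSet (fiberGen p) n) k l := by
  let x : Fin k := ⟨0, by omega⟩
  let y : Fin k := ⟨1, by omega⟩
  have hxy : x ≠ y := by simp [x, y]
  have hw := FreeGroup.lift_commPair_ne_one hxy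
    (FreeGroup.lawWord_ne_one (ne_zero_of_mem_exponents hp i))
  have hnorm := FreeGroup.norm_lift_le (FreeGroup.norm_commPair_le x y)
    (FreeGroup.lawWord (exponents p i))
  have hlen := norm_lawWord_exponents_le hp hp' i
  refine le_trans ?_ (le_iSup₂ (f := fun (w : FreeGroup (Fin k)) (_ : w ≠ 1 ∧ w.norm ≤ (l : ℕ)) =>
    wordComplexity (genSet (fiberGen p) n) w) _ ⟨hw, by omega⟩)
  refine lt_wordComplexity fun g hg => ?_
  refine lift_commPair_eq_one (fun j π h => FreeGroup.map_lawWord_of_commute π h _)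
    (fun j hj π => map_lawWord_fiber ?_ π) x y g hg
  exact Nat.lt_succ_iff.1 (hn.lt_iff_lt.1 (hj.trans_lt hR))

end Lamplighter

theorem one_le_lawlessnessGrowth {G : Type*} [Group G] (S : Set G) {k : ℕ} (hk : 2 ≤ k) (l : ℕ+) :
    1 ≤ lawlessnessGrowth S k l := by
  let x : Fin k := ⟨0, by omega⟩
  refine le_trans ?_ (le_iSup₂ (f := fun (w : FreeGroup (Fin k)) (_ : w ≠ 1 ∧ w.norm ≤ (l : ℕ)) =>
    wordComplexity S w) (.of x) ⟨FreeGroup.of_ne_one x, (FreeGroup.norm_of x).trans_le l.2⟩)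
  have h : ((0 : ℕ) : ℕ∞) + 1 ≤ wordComplexity S (FreeGroup.of x) := by
    refine lt_wordComplexity fun g hg => ?_
    obtain ⟨l, -, h, hl⟩ := hg x
    rw [FreeGroup.lift_apply_of, ← h, List.length_eq_zero_iff.1 (Nat.le_zero.1 hl), List.prod_nil]
  simpa using h

theorem mainTheorem2 (f : ℕ+ → ℕ+) (hf_mono : Monotone f) (hf_unbdd : ¬ BddAbove (Set.range f))
    (g : ℕ+ → ℕ+) (hfg : ∀ n : ℕ+, f (g n) = n)
    (M : ℕ+) (hM : ∀ n : ℕ+, 93 * g n ≤ g (M * n)) :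
    ∃ (Γ : Type) (_ : Group Γ) (S : Set Γ),
      S.Finite ∧ Subgroup.closure S = ⊤ ∧ IsElementaryAmenable Γ ∧ IsLawless Γ ∧
        ∀ k : ℕ, 2 ≤ k →
          GrowthEquiv (lawlessnessGrowth S k) (fun n : ℕ+ => ((f n : ℕ) : ℕ∞)) := by
  have hM2 : 1 < M := by
    by_contra h
    obtain rfl : M = 1 := le_antisymm (not_lt.1 h) one_le
    have h1 : 93 * (g 1 : ℕ) ≤ g 1 := by exact_mod_cast (by simpa using hM 1 : 93 * g 1 ≤ g 1)
    have h2 : 0 < (g 1 : ℕ) := (g 1).2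
    omega
  -- The factor `93 ^ 2 = 8649`, obtained by applying the hypothesis on `g` twice, makes the primes
  -- chosen below grow fast enough for `norm_lawWord_exponents_le`.
  set N : ℕ → ℕ+ := fun j => (M ^ 2) ^ j with hN
  set n : ℕ → ℕ := fun j => N j with hn
  set G : ℕ → ℕ := fun j => g (N j) with hG
  have hB : 1 < ((M ^ 2 : ℕ+) : ℕ) := by
    have : 1 < (M : ℕ) := hM2
    rw [PNat.pow_coe]
    nlinarith
  have hn_apply : ∀ j, n j = ((M ^ 2 : ℕ+) : ℕ) ^ j := fun j => by simp [hn, hN]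
  have hn_mono : StrictMono n := by
    intro i j hij
    rw [hn_apply, hn_apply]
    exact Nat.pow_lt_pow_right hB hij
  have hG_step : ∀ j, 8649 * G j ≤ G (j + 1) := by
    intro j
    have h1 := hM (N j)
    have h2 := hM (M * N j)
    have h3 : M * (M * N j) = N (j + 1) := by
      simp only [hN]
      rw [pow_succ' (M ^ 2) j, pow_two, mul_assoc]
    rw [h3] at h2
    have h1' : 93 * G j ≤ g (M * N j) := by exact_mod_cast h1
    have h2' : 93 * (g (M * N j) : ℕ) ≤ G (j + 1) := by exact_mod_cast h2
    omega
  have hG_pos : ∀ j, 1 ≤ G j := fun j => (g (N j)).2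
  have hG_mono : StrictMono G := strictMono_nat_of_lt_succ fun j => by
    have := hG_step j
    have := hG_pos j
    omega
  have hprime : ∀ j, ∃ q, q.Prime ∧ G j + 5 < q ∧ q ≤ 2 * (G j + 5) := fun j =>
    Nat.exists_prime_lt_and_le_two_mul (G j + 5) (by omega)
  choose p hp_prime hp_lb hp_ub using hprime
  have hp5 : ∀ j, 5 ≤ p j := fun j => by have := hp_lb j; omega
  have hp_step : ∀ j, 16 * p j ≤ p (j + 1) := fun j => by
    have := hp_lb (j + 1)
    have := hp_ub j
    have := hG_step j
    have := hG_pos j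
    omega
  have hp_mono : StrictMono p := strictMono_nat_of_lt_succ fun j => by
    have := hp_step j
    have := hp5 j
    omega
  have hfact : ∀ j, Fact (p j).Prime := fun j => ⟨hp_prime j⟩
  have hn_pos : ∀ j, 1 ≤ n j := fun j => (N j).2
  have hfG : ∀ (j : ℕ) (l : ℕ+), G j ≤ l → n j ≤ f l := by
    intro j l hl
    have h1 : g (N j) ≤ l := by exact_mod_cast hl
    have h2 := hf_mono h1
    rw [hfg] at h2
    exact_mod_cast h2
  have hGf : ∀ (j : ℕ) (l : ℕ+), (l : ℕ) ≤ G j → f l ≤ n j := by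
    intro j l hl
    have h1 : l ≤ g (N j) := by exact_mod_cast hl
    have h2 := hf_mono h1
    rw [hfg] at h2
    exact_mod_cast h2
  refine ⟨Lamplighter.lampGroup (Lamplighter.fiberGen p) n, inferInstance,
    Lamplighter.genSet (Lamplighter.fiberGen p) n, Lamplighter.finite_genSet,
    Lamplighter.closure_genSet, Lamplighter.isElementaryAmenable fun R => ?_,
    Lamplighter.isLawless hp5 hp_mono, fun k hk => ⟨?_, ?_⟩⟩
  · exact (Set.finite_Iic R).subset fun j hj => (hn_mono.le_apply).trans hj
  · have hKpos : 0 < k * (2 * k + 3) * ((M ^ 2 : ℕ+) : ℕ) * (2 * k + 1) := by positivity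
    obtain ⟨K, hK⟩ : ∃ K : ℕ+, (K : ℕ) = k * (2 * k + 3) * ((M ^ 2 : ℕ+) : ℕ) * (2 * k + 1) :=
      ⟨⟨_, hKpos⟩, rfl⟩
    refine ⟨K, fun l => ?_⟩
    have hex : ∃ j, (2 * k + 1) * (l : ℕ) < p j :=
      ⟨_, (Nat.lt_succ_self _).trans_le (hp_mono.le_apply (x := (2 * k + 1) * (l : ℕ) + 1))⟩
    have hj := Nat.find_spec hex
    have hmin := fun i => Nat.find_min (m := i) hex
    set j := Nat.find hex
    refine (Lamplighter.lawlessnessGrowth_le hp5 hj).trans ?_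
    -- The previous index is too small, which bounds `n j` in terms of `f`.
    have hnj : n j ≤ ((M ^ 2 : ℕ+) : ℕ) * f (K * l) := by
      rcases Nat.eq_zero_or_pos j with h0 | h0
      · have h1 : n j = 1 := by rw [hn_apply, h0, pow_zero]
        rw [h1]
        exact Nat.mul_pos (PNat.pos _) (PNat.pos _)
      · obtain ⟨i, hi⟩ : ∃ i, j = i + 1 := ⟨j - 1, by omega⟩
        have h1 := hmin i (by omega)
        have h2 := hp_lb i
        have hle : 2 * k + 1 ≤ (K : ℕ) := by
          rw [hK]
          exact Nat.le_mul_of_pos_left _ (by positivity)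
        have h3 : G i ≤ ((K * l : ℕ+) : ℕ) := by
          rw [PNat.mul_coe]
          have := Nat.mul_le_mul_right (l : ℕ) hle
          omega
        rw [hi, hn_apply, pow_succ', ← hn_apply]
        exact Nat.mul_le_mul_left _ (hfG i _ h3)
    have h4 : k * (2 * k + 2 * n j + 1) ≤ K * f (K * l) := by
      have hj1 := hn_pos j
      calc k * (2 * k + 2 * n j + 1) ≤ k * ((2 * k + 3) * n j) := by
            refine Nat.mul_le_mul_left _ ?_
            nlinarith
        _ ≤ k * ((2 * k + 3) * (((M ^ 2 : ℕ+) : ℕ) * f (K * l))) := by gcongr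
        _ = k * (2 * k + 3) * ((M ^ 2 : ℕ+) : ℕ) * 1 * f (K * l) := by ring
        _ ≤ K * f (K * l) := by
          rw [hK]
          gcongr
          omega
    refine (Nat.cast_le.2 h4).trans (le_of_eq ?_)
    push_cast
    rfl
  -- The law for the index `i` has length at most `480 * p i`, and `p i ≤ 12 * G i`. This explains
  -- the constant `5760 = 480 * 12`.
  · refine ⟨5760, fun l => ?_⟩
    have hex : ∃ j, (l : ℕ) ≤ G j := ⟨l, hG_mono.le_apply⟩
    have hj := Nat.find_spec hex
    have hmin := fun i => Nat.find_min (m := i) hex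
    set j := Nat.find hex
    have hfl := hGf j l hj
    obtain ⟨R, hR, hle⟩ : ∃ R : ℕ, f l ≤ 5760 * (R + 1) ∧
        (R : ℕ∞) + 1 ≤ lawlessnessGrowth (Lamplighter.genSet (Lamplighter.fiberGen p) n) k
          (5760 * l) := by
      rcases Nat.eq_zero_or_pos j with h0 | h0
      · refine ⟨0, ?_, by simpa using one_le_lawlessnessGrowth _ hk _⟩
        have h1 : n j = 1 := by rw [hn_apply, h0, pow_zero]
        omega
      · obtain ⟨i, hi⟩ : ∃ i, j = i + 1 := ⟨j - 1, by omega⟩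
        have h1 := hmin i (by omega)
        have h2 := hp_ub i
        have h3 := hG_pos i
        have h4 := hn_pos j
        rw [hi] at hfl h4
        refine ⟨(n (i + 1) - 1) / 16, by omega,
          Lamplighter.le_lawlessnessGrowth hp5 hp_step hn_mono hk (i := i) (by omega) ?_⟩
        rw [PNat.mul_coe]
        change 480 * p i ≤ 5760 * (l : ℕ)
        omega
    calc ((f l : ℕ) : ℕ∞) ≤ ((5760 * (R + 1) : ℕ) : ℕ∞) := by exact_mod_cast hR
      _ = ((5760 : ℕ) : ℕ∞) * ((R : ℕ∞) + 1) := by push_cast; rfl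
      _ ≤ _ := mul_le_mul_right hle _
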